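/- Let $S$ be a finite set and let $M=(m_{s\,t})_{s,t\in S}$ be a Coxeter matrix over $S$, that is, $m_{s\,s}=1$ for all $s\in S$ and $m_{s\,t}=m_{t\,s}\in\{2,3,4,\dots,+\infty\}$ for all $s\neq t$. Let $\Gamma$ be its Coxeter graph: its set of vertices is $S$, and two distinct vertices $s,t$ are joined by an edge if $m_{s\,t}\ge 3$ (including $m_{s\,t}=+\infty$). Let $W$ be the Coxeter group of type $\Gamma$, that is, the group generated by $S$ subject to the relations $s^2=1$ for $s\in S$ and $(st)^{m_{s\,t}}=1$ for $s\neq t$ with $m_{s\,t}<+\infty$. The canonical form of $\Gamma$ is the symmetric bilinear form on the real vector space $V=\bigoplus_{s\in S}\mathbb{R}\alpha_s$ given by $\langle\alpha_s,\alpha_t\rangle=-\cos(\pi/m_{s\,t})$ if $m_{s\,t}<+\infty$ and $\langle\alpha_s,\alpha_t\rangle=-1$ if $m_{s\,t}=+\infty$; $\Gamma$ is said to be of spherical type if this form is positive definite. **Proposition 4.3.** Assume that $\Gamma$ is connected and not of spherical type. Let $H$ be a non-trivial finite subgroup of $W$. Then the normalizer $N_W(H)=\{w\in W : wHw^{-1}=H\}$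 has infinite index in $W$. -/

import Mathlib

/-- The Coxeter graph of a Coxeter matrix `M`, without its edge labels: the vertices are the indices,
and two distinct vertices `s`, `t` are joined exactly when `m_{s t} ≥ 3` or `m_{s t} = ∞`.
Mathlib encodes `m_{s t} = ∞` as `M s t = 0`. -/
def coxeterGraph {S : Type*} (M : CoxeterMatrix S) : SimpleGraph S where
  Adj s t := s ≠ t ∧ (M s t = 0 ∨ 3 ≤ M s t)
  symm := ⟨fun s t h => ⟨h.1.symm, by rw [M.symmetric t s]; exact h.2⟩⟩
  loopless := ⟨fun _ h => h.1 rfl⟩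

open Classical in
/-- The canonical form `⟨·,·⟩` of a Coxeter matrix over a finite set `S`, on the real vector space
`S → ℝ` whose standard basis vector `Pi.single s 1` is the simple root `α_s`. -/
noncomputable def canonicalForm {S : Type*} [Fintype S] (M : CoxeterMatrix S) :
    LinearMap.BilinForm ℝ (S → ℝ) :=
  Matrix.toBilin' (Matrix.of fun s t =>
    if M s t = 0 then (-1 : ℝ) else -Real.cos (Real.pi / (M s t : ℝ)))

open Classical in
theorem canonicalForm_simpleRoot {S : Type*} [Fintype S] (M : CoxeterMatrix S) (s t : S) :
    canonicalForm M (Pi.single s 1) (Pi.single t 1) =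
      if M s t = 0 then (-1 : ℝ) else -Real.cos (Real.pi / (M s t : ℝ)) := by
  simp [canonicalForm, Matrix.toBilin'_single]

/-- A Coxeter graph is of spherical type if its canonical form is positive definite. -/
def IsSpherical {S : Type*} [Fintype S] (M : CoxeterMatrix S) : Prop :=
  ∀ x : S → ℝ, x ≠ 0 → 0 < canonicalForm M x x

/-! If `H` had a normalizer of finite index, it would have finitely many conjugates, each element of
which has finite order. Dietzmann's lemma then makes the normal closure of `H` finite
(`finite_normalClosure`), so it suffices that `W` has no non-trivial finite normal subgroup `K`
(`eq_bot_of_finite_of_normal`).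

Let `P` be the sum of the elements of `K` in the geometric representation. Its kernel is `W`-stable
because `K` is normal. If the kernel leaves the radical of the canonical form, connectedness puts
every simple root in it, so `P = 0`. Each root then has a nonpositive image under some element of
`K`; by finiteness of inversion sets there are finitely many roots, so `W` is finite and the form
positive definite, a contradiction. If the kernel lies in the radical, `W` fixes it pointwise, so
`P` is multiplication by the order of `K` there and the kernel is zero. It contains every `k v - v`,
so `K` acts trivially, and faithfulness gives `K = ⊥`. -/

open Classical in
/-- The simple root `α_i`, as a basis vector of `S → ℝ`. -/
noncomputable def simpleRoot {S : Type*} (i : S) : S → ℝ := Pi.single i 1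

/-! ### Simple reflections and the dihedral relations. -/

section Geometry

variable {S : Type*} (M : CoxeterMatrix S)

theorem simpleRoot_apply_self (i : S) : simpleRoot i i = 1 := by simp [simpleRoot]

theorem simpleRoot_apply_ne {i j : S} (h : j ≠ i) : simpleRoot i j = 0 := by simp [simpleRoot, h]

theorem simpleRoot_nonneg (i : S) : 0 ≤ simpleRoot i := by
  classical
  exact Pi.single_nonneg.2 zero_le_one

/-- The coefficients of the roots of the dihedral group generated by two simple reflections. -/
noncomputable def dihedralCoeff (i j : S) (m : ℕ) : ℝ :=
  if M i j = 0 then m else Real.sin (m * (Real.pi / M i j)) / Real.sin (Real.pi / M i j)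

theorem two_le_of_ne {i j : S} (hij : i ≠ j) (h0 : M i j ≠ 0) : 2 ≤ M i j := by
  have := M.off_diagonal i j hij
  omega

theorem sin_pi_div_pos {i j : S} (hij : i ≠ j) (h0 : M i j ≠ 0) :
    0 < Real.sin (Real.pi / M i j) := by
  have h2 : (2 : ℝ) ≤ M i j := by exact_mod_cast two_le_of_ne M hij h0
  apply Real.sin_pos_of_pos_of_lt_pi
  · have := Real.pi_pos
    positivity
  · rw [div_lt_iff₀ (by linarith)]
    nlinarith [Real.pi_pos]

theorem dihedralCoeff_zero (i j : S) : dihedralCoeff M i j 0 = 0 := by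
  simp [dihedralCoeff]

theorem dihedralCoeff_one {i j : S} (hij : i ≠ j) : dihedralCoeff M i j 1 = 1 := by
  unfold dihedralCoeff
  split_ifs with h
  · simp
  · simp [(sin_pi_div_pos M hij h).ne']

theorem dihedralCoeff_nonneg {i j : S} (hij : i ≠ j) {m : ℕ} (hm : M i j ≠ 0 → m ≤ M i j) :
    0 ≤ dihedralCoeff M i j m := by
  unfold dihedralCoeff
  split_ifs with h
  · positivity
  · refine div_nonneg (Real.sin_nonneg_of_nonneg_of_le_pi ?_ ?_) (sin_pi_div_pos M hij h).le
    · have := Real.pi_pos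
      positivity
    · have hm' : (m : ℝ) ≤ M i j := by exact_mod_cast hm h
      have h0 : (0 : ℝ) < M i j := by positivity
      rw [← mul_div_assoc, div_le_iff₀ h0]
      nlinarith [Real.pi_pos]

variable [Fintype S]

theorem linearMap_ext_simpleRoot {E : Type*} [AddCommGroup E] [Module ℝ E]
    {f g : (S → ℝ) →ₗ[ℝ] E} (h : ∀ i, f (simpleRoot i) = g (simpleRoot i)) : f = g := by
  classical
  refine LinearMap.pi_ext' fun i => LinearMap.ext_ring ?_
  simpa [simpleRoot] using h i

theorem canonicalForm_root_root (i j : S) :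
    canonicalForm M (simpleRoot i) (simpleRoot j) =
      if M i j = 0 then (-1 : ℝ) else -Real.cos (Real.pi / (M i j : ℝ)) :=
  canonicalForm_simpleRoot M i j

theorem canonicalForm_comm (x y : S → ℝ) : canonicalForm M x y = canonicalForm M y x := by
  have : canonicalForm M = (canonicalForm M).flip :=
    linearMap_ext_simpleRoot fun i => linearMap_ext_simpleRoot fun j => by
      change _ = canonicalForm M (simpleRoot j) (simpleRoot i)
      rw [canonicalForm_root_root, canonicalForm_root_root, M.symmetric i j]
  exact LinearMap.congr_fun₂ this x y

theorem canonicalForm_root_self (i : S) :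
    canonicalForm M (simpleRoot i) (simpleRoot i) = 1 := by
  simp [canonicalForm_root_root]

/-- The reflection `v ↦ v - 2 ⟨α_i, v⟩ α_i`. -/
noncomputable def simpleReflection (i : S) : Module.End ℝ (S → ℝ) :=
  Module.preReflection (simpleRoot i) ((2 : ℝ) • canonicalForm M (simpleRoot i))

theorem simpleReflection_apply (i : S) (v : S → ℝ) :
    simpleReflection M i v = v - (2 * canonicalForm M (simpleRoot i) v) • simpleRoot i := by
  simp [simpleReflection, Module.preReflection_apply]

theorem simpleReflection_root_self (i : S) :
    simpleReflection M i (simpleRoot i) = -simpleRoot i := by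
  rw [simpleReflection_apply, canonicalForm_root_self]
  module

theorem simpleReflection_apply_ne {i j : S} (h : j ≠ i) (v : S → ℝ) :
    simpleReflection M i v j = v j := by
  simp [simpleReflection_apply, simpleRoot_apply_ne h]

theorem simpleReflection_mul_self (i : S) :
    simpleReflection M i * simpleReflection M i = 1 := by
  refine LinearMap.ext fun v => ?_
  exact Module.involutive_preReflection (by simp [canonicalForm_root_self]) _

theorem canonicalForm_simpleReflection (i : S) (x y : S → ℝ) :
    canonicalForm M (simpleReflection M i x) (simpleReflection M i y) = canonicalForm M x y := by
  simp only [simpleReflection_apply, map_sub, map_smul, LinearMap.sub_apply, LinearMap.smul_apply,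
    smul_eq_mul, canonicalForm_root_self, canonicalForm_comm M x (simpleRoot i)]
  ring

/-- The Chebyshev recurrence; the case `M i j = 0` is the limit of angle zero. -/
theorem dihedralCoeff_add_two (i j : S) (m : ℕ) :
    dihedralCoeff M i j (m + 2) =
      -2 * canonicalForm M (simpleRoot i) (simpleRoot j) * dihedralCoeff M i j (m + 1)
        - dihedralCoeff M i j m := by
  rw [canonicalForm_root_root]
  unfold dihedralCoeff
  split_ifs with h
  · push_cast; ring
  · set θ := Real.pi / M i j
    have h1 : ((m + 2 : ℕ) : ℝ) * θ = (m + 1 : ℕ) * θ + θ := by push_cast; ring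
    have h2 : (m : ℝ) * θ = (m + 1 : ℕ) * θ - θ := by push_cast; ring
    rw [h1, h2, Real.sin_add, Real.sin_sub]
    ring

theorem reflection_root_pair (i j : S) (x y : ℝ) :
    simpleReflection M i (x • simpleRoot i + y • simpleRoot j) =
      (-2 * canonicalForm M (simpleRoot i) (simpleRoot j) * y - x) • simpleRoot i
        + y • simpleRoot j := by
  simp only [simpleReflection_apply, map_add, map_smul, canonicalForm_root_self]
  module

theorem reflection_root_pair' (i j : S) (x y : ℝ) :
    simpleReflection M j (x • simpleRoot i + y • simpleRoot j) =
      x • simpleRoot i +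
      (-2 * canonicalForm M (simpleRoot i) (simpleRoot j) * x - y) • simpleRoot j := by
  rw [add_comm, reflection_root_pair, canonicalForm_comm M, add_comm]

theorem rotation_pow_root {i j : S} (hij : i ≠ j) (n : ℕ) :
    ((simpleReflection M i * simpleReflection M j) ^ n) (simpleRoot i) =
      dihedralCoeff M i j (2 * n + 1) • simpleRoot i
        + dihedralCoeff M i j (2 * n) • simpleRoot j := by
  induction n with
  | zero => simp [dihedralCoeff_zero, dihedralCoeff_one M hij]
  | succ n ih =>
    rw [pow_succ', Module.End.mul_apply, ih, Module.End.mul_apply, reflection_root_pair',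
      reflection_root_pair]
    have h1 := dihedralCoeff_add_two M i j (2 * n)
    have h2 := dihedralCoeff_add_two M i j (2 * n + 1)
    rw [show 2 * (n + 1) + 1 = 2 * n + 1 + 2 by ring, show 2 * (n + 1) = 2 * n + 2 by ring, h2,
      show 2 * n + 1 + 1 = 2 * n + 2 by ring, h1]

theorem rotation_pow_root' {i j : S} (hij : i ≠ j) (n : ℕ) :
    ((simpleReflection M i * simpleReflection M j) ^ n) (simpleRoot j) =
      (-dihedralCoeff M i j (2 * n)) • simpleRoot i
        + (dihedralCoeff M i j (2 * n + 1) + 2 *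
          canonicalForm M (simpleRoot i) (simpleRoot j) * dihedralCoeff M i j (2 * n))
           • simpleRoot j := by
  induction n with
  | zero => simp [dihedralCoeff_zero, dihedralCoeff_one M hij]
  | succ n ih =>
    rw [pow_succ', Module.End.mul_apply, ih, Module.End.mul_apply, reflection_root_pair',
      reflection_root_pair]
    have h1 := dihedralCoeff_add_two M i j (2 * n)
    have h2 := dihedralCoeff_add_two M i j (2 * n + 1)
    rw [show 2 * (n + 1) + 1 = 2 * n + 1 + 2 by ring, show 2 * (n + 1) = 2 * n + 2 by ring, h2,
      show 2 * n + 1 + 1 = 2 * n + 2 by ring, h1]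
    congr 2 <;> ring

theorem rotation_pow_order {i j : S} (hij : i ≠ j) :
    (simpleReflection M i * simpleReflection M j) ^ M i j = 1 := by
  by_cases h0 : M i j = 0
  · simp [h0]
  have hs := sin_pi_div_pos M hij h0
  have hM : (M i j : ℝ) ≠ 0 := by exact_mod_cast h0
  have c0 : dihedralCoeff M i j (2 * M i j) = 0 := by
    rw [dihedralCoeff, if_neg h0]
    rw [show ((2 * M i j : ℕ) : ℝ) * (Real.pi / M i j) = 2 * Real.pi by push_cast; field_simp]
    simp
  have c1 : dihedralCoeff M i j (2 * M i j + 1) = 1 := by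
    rw [dihedralCoeff, if_neg h0]
    rw [show ((2 * M i j + 1 : ℕ) : ℝ) * (Real.pi / M i j) = Real.pi / M i j + 2 * Real.pi by
      push_cast; field_simp; ring]
    rw [Real.sin_add_two_pi, div_self hs.ne']
  have hi := rotation_pow_root M hij (M i j)
  have hj := rotation_pow_root' M hij (M i j)
  simp only [c0, c1, one_smul, zero_smul, neg_zero, mul_zero, add_zero, zero_add] at hi hj
  refine LinearMap.ext fun v => ?_
  set c := canonicalForm M (simpleRoot i) (simpleRoot j) with hc
  have hc2 : 1 - c ^ 2 ≠ 0 := by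
    rw [hc, canonicalForm_root_root, if_neg h0]
    have := Real.sin_sq_add_cos_sq (Real.pi / M i j)
    have : 0 < Real.sin (Real.pi / M i j) ^ 2 := by positivity
    nlinarith
  -- Cramer's rule for the orthogonal projection of `v` to the plane of the two roots, where the
  -- form has determinant `1 - c ^ 2`. Both reflections fix the remainder `u`.
  set p := (canonicalForm M (simpleRoot i) v - c * canonicalForm M (simpleRoot j) v) / (1 - c ^ 2)
    with hp
  set q := (canonicalForm M (simpleRoot j) v - c * canonicalForm M (simpleRoot i) v) / (1 - c ^ 2)
    with hq
  obtain ⟨u, hu⟩ : ∃ u, u = v - p • simpleRoot i - q • simpleRoot j := ⟨_, rfl⟩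
  have hui : simpleReflection M i u = u := by
    have : canonicalForm M (simpleRoot i) u = 0 := by
      simp only [hu, map_sub, map_smul, canonicalForm_root_self, ← hc, smul_eq_mul, hp, hq]
      field_simp
      ring
    simp [simpleReflection_apply, this]
  have huj : simpleReflection M j u = u := by
    have : canonicalForm M (simpleRoot j) u = 0 := by
      simp only [hu, map_sub, map_smul, canonicalForm_root_self,
        canonicalForm_comm M (simpleRoot j) (simpleRoot i), ← hc, smul_eq_mul, hp, hq]
      field_simp
      ring
    simp [simpleReflection_apply, this]
  have hu' : ∀ n : ℕ, ((simpleReflection M i * simpleReflection M j) ^ n) u = u := by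
    intro n
    induction n with
    | zero => simp
    | succ n ih => rw [pow_succ', Module.End.mul_apply, ih, Module.End.mul_apply, huj, hui]
  have hv : v = u + p • simpleRoot i + q • simpleRoot j := by rw [hu]; module
  rw [hv, map_add, map_add, map_smul, map_smul, hi, hj, hu']
  simp

theorem simpleReflection_isLiftable : M.IsLiftable (simpleReflection M) := by
  intro i j
  rcases eq_or_ne i j with rfl | hij
  · simp [simpleReflection_mul_self]
  · exact rotation_pow_order M hij

end Geometry

/-! ### The geometric representation. -/

namespace CoxeterSystem

variable {S : Type*} [Fintype S] {M : CoxeterMatrix S} {W : Type*} [Group W]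
  (cs : CoxeterSystem M W)

/-- The geometric representation of a Coxeter group. -/
noncomputable def geomRep : W →* Module.End ℝ (S → ℝ) :=
  cs.lift ⟨simpleReflection M, simpleReflection_isLiftable M⟩

theorem geomRep_simple (i : S) : cs.geomRep (cs.simple i) = simpleReflection M i :=
  cs.lift_apply_simple _ i

theorem geomRep_inv_apply (w : W) (v : S → ℝ) : cs.geomRep w⁻¹ (cs.geomRep w v) = v := by
  rw [← Module.End.mul_apply, ← map_mul]; simp

theorem canonicalForm_geomRep (w : W) (x y : S → ℝ) :
    canonicalForm M (cs.geomRep w x) (cs.geomRep w y) = canonicalForm M x y := by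
  induction w using cs.simple_induction_left generalizing x y with
  | one => simp
  | mul_simple_left w i ih =>
    rw [map_mul, geomRep_simple, Module.End.mul_apply, Module.End.mul_apply,
      canonicalForm_simpleReflection, ih]

theorem geomRep_alternatingWord {i j : S} (hij : i ≠ j) (m : ℕ) :
    cs.geomRep (cs.wordProd (alternatingWord i j m)) (simpleRoot i) =
      dihedralCoeff M i j (if Even m then m + 1 else m) • simpleRoot i
        + dihedralCoeff M i j (if Even m then m else m + 1) • simpleRoot j := by
  induction m with
  | zero => simp [alternatingWord, dihedralCoeff_zero, dihedralCoeff_one M hij]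
  | succ m ih =>
    rw [alternatingWord_succ', wordProd_cons, map_mul, Module.End.mul_apply, ih, geomRep_simple]
    by_cases h : Even m
    · simp only [h, if_true, Nat.even_add_one, not_true, if_false]
      rw [reflection_root_pair', dihedralCoeff_add_two]
    · simp only [h, if_false, Nat.even_add_one, not_false_eq_true, if_true]
      rw [reflection_root_pair, dihedralCoeff_add_two]

theorem geomRep_alternatingWord_nonneg {i j : S} (hij : i ≠ j) {m : ℕ}
    (hm : cs.IsReduced (alternatingWord j i (m + 1))) :
    ∃ x y : ℝ, 0 ≤ x ∧ 0 ≤ y ∧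
    cs.geomRep (cs.wordProd (alternatingWord i j m)) (simpleRoot i) =
      x • simpleRoot i + y • simpleRoot j := by
  have hm' : M i j ≠ 0 → m + 1 ≤ M i j := by
    intro h0
    by_contra! hlt
    rw [M.symmetric] at h0 hlt
    exact cs.not_isReduced_alternatingWord j i h0 hlt hm
  refine ⟨_, _, ?_, ?_, cs.geomRep_alternatingWord hij m⟩ <;>
  · apply dihedralCoeff_nonneg M hij
    intro h0
    have := hm' h0
    split_ifs <;> omega

end CoxeterSystem

/-! ### Positive and negative roots, faithfulness, finiteness. -/

namespace CoxeterSystem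

section Roots

variable {S : Type*} [Fintype S] {M : CoxeterMatrix S} {W : Type*} [Group W]
  (cs : CoxeterSystem M W)

/-- Induction on length: split off from the right of `w` the longest possible alternating word in
`i`, `j`. The remaining `v` is shorter and has neither letter as a descent, while the dihedral part
sends the root to a nonnegative combination of the two simple roots. -/
theorem geomRep_root_nonneg {w : W} {i : S} (h : ¬ cs.IsRightDescent w i) :
    0 ≤ cs.geomRep w (simpleRoot i) := by
  induction hn : cs.length w using Nat.strong_induction_on generalizing w i with
  | _ n ih =>
  rcases eq_or_ne w 1 with rfl | hw
  · simpa using simpleRoot_nonneg i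
  obtain ⟨j, hj⟩ := cs.exists_rightDescent_of_ne_one hw
  have hij : i ≠ j := by rintro rfl; exact h hj
  classical
  let P : ℕ → Prop := fun m => ∃ v, w = v * cs.wordProd (alternatingWord i j m) ∧
    cs.length w = cs.length v + m
  have hP1 : P 1 := by
    refine ⟨w * cs.simple j, by simp [alternatingWord], ?_⟩
    rw [cs.isRightDescent_iff] at hj
    exact hj.symm
  have hle : 1 ≤ cs.length w := by
    obtain ⟨v, -, hv⟩ := hP1
    omega
  set m := Nat.findGreatest P (cs.length w) with hm
  have hPm : P m := Nat.findGreatest_spec hle hP1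
  have hm1 : 1 ≤ m := Nat.le_findGreatest hle hP1
  have hmax : ¬ P (m + 1) := by
    intro hp
    have : m + 1 ≤ cs.length w := by
      obtain ⟨v, -, hv⟩ := hp
      omega
    exact absurd (Nat.le_findGreatest this hp) (by omega)
  obtain ⟨v, hwv, hlen⟩ := hPm
  -- This letter would lengthen the alternating word, against maximality of `m`.
  have next : ¬ cs.IsRightDescent v (if Even m then j else i) := by
    intro hd
    refine hmax ⟨v * cs.simple (if Even m then j else i), ?_, ?_⟩
    · rw [alternatingWord_succ', wordProd_cons, mul_assoc, simple_mul_simple_cancel_left, hwv]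
    · rw [cs.isRightDescent_iff] at hd
      omega
  -- This is the first letter of the word; cancelling it into `v` would make `w` too short.
  have prev : ¬ cs.IsRightDescent v (if Even m then i else j) := by
    obtain ⟨k, hk⟩ : ∃ k, m = k + 1 := ⟨m - 1, by omega⟩
    have hpar : (if Even m then i else j) = if Even k then j else i := by
      rw [hk]
      by_cases hk' : Even k <;> simp [hk', Nat.even_add_one]
    rw [hpar, CoxeterSystem.IsRightDescent]
    have h1 : w = v * cs.simple (if Even k then j else i) *
        cs.wordProd (alternatingWord i j k) := by
      rw [hwv, hk, alternatingWord_succ', wordProd_cons, mul_assoc]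
    have h2 := cs.length_mul_le (v * cs.simple (if Even k then j else i))
      (cs.wordProd (alternatingWord i j k))
    have h3 := cs.length_wordProd_le (alternatingWord i j k)
    rw [← h1] at h2
    rw [length_alternatingWord] at h3
    omega
  have hvi : ¬ cs.IsRightDescent v i := by
    by_cases hm : Even m
    · simpa [hm] using prev
    · simpa [hm] using next
  have hvj : ¬ cs.IsRightDescent v j := by
    by_cases hm : Even m
    · simpa [hm] using next
    · simpa [hm] using prev
  have hred : cs.IsReduced (alternatingWord j i (m + 1)) := by
    rw [cs.not_isRightDescent_iff] at h
    have h1 : w * cs.simple i = v * cs.wordProd (alternatingWord j i (m + 1)) := by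
      rw [alternatingWord_succ, wordProd_concat, hwv, mul_assoc]
    have h2 := cs.length_mul_le v (cs.wordProd (alternatingWord j i (m + 1)))
    have h3 := cs.length_wordProd_le (alternatingWord j i (m + 1))
    rw [← h1] at h2
    rw [CoxeterSystem.IsReduced]
    rw [length_alternatingWord] at h3 ⊢
    omega
  obtain ⟨x, y, hx, hy, hxy⟩ := cs.geomRep_alternatingWord_nonneg hij hred
  rw [hwv, map_mul, Module.End.mul_apply, hxy, map_add, map_smul, map_smul]
  exact add_nonneg (smul_nonneg hx (ih _ (by omega) hvi rfl))
    (smul_nonneg hy (ih _ (by omega) hvj rfl))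

theorem geomRep_root_nonpos {w : W} {i : S} (h : cs.IsRightDescent w i) :
    cs.geomRep w (simpleRoot i) ≤ 0 := by
  have h' := cs.geomRep_root_nonneg (cs.isRightDescent_iff_not_isRightDescent_mul.1 h)
  rw [map_mul, Module.End.mul_apply, geomRep_simple, simpleReflection_root_self, map_neg] at h'
  exact neg_nonneg.1 h'

theorem geomRep_injective : Function.Injective cs.geomRep := by
  rw [injective_iff_map_eq_one]
  intro w hw
  by_contra hne
  obtain ⟨i, hi⟩ := cs.exists_rightDescent_of_ne_one hne
  have := cs.geomRep_root_nonpos hi i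
  rw [hw, Module.End.one_apply, simpleRoot_apply_self, Pi.zero_apply] at this
  linarith

/-- The root system of a Coxeter system: the orbit of the simple roots. -/
def roots : Set (S → ℝ) := {v | ∃ w i, cs.geomRep w (simpleRoot i) = v}

variable {cs} in
theorem geomRep_mem_roots {v : S → ℝ} (hv : v ∈ cs.roots) (w : W) :
    cs.geomRep w v ∈ cs.roots := by
  obtain ⟨u, i, rfl⟩ := hv
  exact ⟨w * u, i, by rw [map_mul, Module.End.mul_apply]⟩

variable {cs} in
theorem neg_mem_roots {v : S → ℝ} (hv : v ∈ cs.roots) : -v ∈ cs.roots := by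
  obtain ⟨u, i, rfl⟩ := hv
  refine ⟨u * cs.simple i, i, ?_⟩
  rw [map_mul, Module.End.mul_apply, geomRep_simple, simpleReflection_root_self, map_neg]

variable {cs} in
theorem nonneg_or_nonpos_of_mem_roots {v : S → ℝ} (hv : v ∈ cs.roots) : 0 ≤ v ∨ v ≤ 0 := by
  obtain ⟨u, i, rfl⟩ := hv
  by_cases h : cs.IsRightDescent u i
  · exact .inr (cs.geomRep_root_nonpos h)
  · exact .inl (cs.geomRep_root_nonneg h)

variable {cs} in
theorem canonicalForm_self_of_mem_roots {v : S → ℝ} (hv : v ∈ cs.roots) :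
    canonicalForm M v v = 1 := by
  obtain ⟨u, i, rfl⟩ := hv
  rw [canonicalForm_geomRep, canonicalForm_root_self]

variable {cs} in
-- The reflection changes only coordinate `i`, so all others vanish; norm one fixes the scalar.
theorem eq_simpleRoot_of_reflection_nonpos {v : S → ℝ} (hv : v ∈ cs.roots) (h0 : 0 ≤ v) {i : S}
    (hi : simpleReflection M i v ≤ 0) : v = simpleRoot i := by
  have hv' : v = v i • simpleRoot i := by
    ext j
    rcases eq_or_ne j i with rfl | hj
    · simp [simpleRoot_apply_self]
    · have h1 := hi j
      rw [simpleReflection_apply_ne M hj] at h1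
      simpa [simpleRoot_apply_ne hj] using le_antisymm h1 (h0 j)
  have hB := canonicalForm_self_of_mem_roots hv
  rw [hv', map_smul, map_smul, LinearMap.smul_apply, canonicalForm_root_self, smul_eq_mul,
    smul_eq_mul, mul_one] at hB
  have hvi : v i = 1 := by
    have := h0 i
    rw [Pi.zero_apply] at this
    nlinarith
  rw [hv', hvi, one_smul]

theorem finite_inversions (w : W) :
    {v | v ∈ cs.roots ∧ 0 ≤ v ∧ cs.geomRep w v ≤ 0}.Finite := by
  induction w using cs.simple_induction_left with
  | one =>
    refine (Set.finite_singleton 0).subset ?_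
    rintro v ⟨-, h0, h1⟩
    exact le_antisymm (by simpa using h1) h0
  | mul_simple_left w i ih =>
    refine (ih.insert (cs.geomRep w⁻¹ (simpleRoot i))).subset ?_
    rintro v ⟨hv, h0, h1⟩
    rcases nonneg_or_nonpos_of_mem_roots (geomRep_mem_roots hv w) with h | h
    · left
      rw [map_mul, geomRep_simple, Module.End.mul_apply] at h1
      rw [← eq_simpleRoot_of_reflection_nonpos (geomRep_mem_roots hv w) h h1,
        geomRep_inv_apply]
    · exact .inr ⟨hv, h0, h⟩

theorem finite_of_finite_roots (h : cs.roots.Finite) : Finite W := by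
  have := h.to_subtype
  refine Finite.of_injective
    (fun (w : W) (i : S) => (⟨cs.geomRep w (simpleRoot i), w, i, rfl⟩ : cs.roots)) ?_
  intro w w' hww
  refine cs.geomRep_injective (linearMap_ext_simpleRoot fun i => ?_)
  exact congrArg Subtype.val (congrFun hww i)

theorem finite_of_forall_exists_nonpos (K : Set W) (hK : K.Finite)
    (h : ∀ v ∈ cs.roots, ∃ k ∈ K, cs.geomRep k v ≤ 0) : Finite W := by
  have hpos : {v | v ∈ cs.roots ∧ 0 ≤ v}.Finite := by
    refine (hK.biUnion fun k _ => cs.finite_inversions k).subset ?_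
    rintro v ⟨hv, h0⟩
    obtain ⟨k, hk, hkv⟩ := h v hv
    exact Set.mem_biUnion hk ⟨hv, h0, hkv⟩
  refine cs.finite_of_finite_roots ((hpos.union (hpos.image Neg.neg)).subset fun v hv => ?_)
  rcases nonneg_or_nonpos_of_mem_roots hv with h0 | h0
  · exact .inl ⟨hv, h0⟩
  · exact .inr ⟨-v, ⟨neg_mem_roots hv, neg_nonneg.2 h0⟩, neg_neg v⟩

end Roots

end CoxeterSystem

/-! ### Invariant forms on a connected graph. -/

section Connected

variable {S : Type*} [Fintype S] {M : CoxeterMatrix S}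

theorem canonicalForm_ne_zero_of_adj {i j : S} (h : (coxeterGraph M).Adj i j) :
    canonicalForm M (simpleRoot i) (simpleRoot j) ≠ 0 := by
  rw [canonicalForm_root_root]
  split_ifs with h0
  · norm_num
  · have h3 : (3 : ℝ) ≤ M i j := by exact_mod_cast h.2.resolve_left h0
    have hpi := Real.pi_pos
    refine neg_ne_zero.2 (Real.cos_pos_of_mem_Ioo ⟨?_, ?_⟩).ne'
    · have : 0 < Real.pi / M i j := by positivity
      linarith
    · rw [div_lt_div_iff₀ (by linarith) two_pos]
      nlinarith

theorem forall_of_adj_of_connected {V : Type*} {G : SimpleGraph V} (hG : G.Connected) {p : V → Prop}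
    (hadj : ∀ i j, G.Adj i j → p i → p j) {i : V} (hi : p i) (j : V) : p j := by
  obtain ⟨w⟩ := hG.preconnected i j
  induction w with
  | nil => exact hi
  | cons h _ ih => exact ih (hadj _ _ h hi)

/-- Invariance makes each simple root `D`-orthogonal to its reflecting hyperplane, so `D` is
proportional to the canonical form in that row. Symmetry equates the factors along edges. -/
theorem isSpherical_of_invariant_form (hconn : (coxeterGraph M).Connected)
    (D : LinearMap.BilinForm ℝ (S → ℝ)) (hsymm : ∀ x y, D x y = D y x)
    (hpos : ∀ x, x ≠ 0 → 0 < D x x)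
    (hinv : ∀ i x y, D (simpleReflection M i x) (simpleReflection M i y) = D x y) :
    IsSpherical M := by
  have key : ∀ i v, D (simpleRoot i) v =
      D (simpleRoot i) (simpleRoot i) * canonicalForm M (simpleRoot i) v := by
    intro i v
    set u := v - canonicalForm M (simpleRoot i) v • simpleRoot i with hu
    have hfix : simpleReflection M i u = u := by
      simp [simpleReflection_apply, hu, canonicalForm_root_self]
    have h := hinv i (simpleRoot i) u
    rw [hfix, simpleReflection_root_self, map_neg, LinearMap.neg_apply] at h
    have h0 : D (simpleRoot i) u = 0 := by linarith
    rw [hu, map_sub, map_smul, smul_eq_mul] at h0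
    linarith
  obtain ⟨o⟩ := hconn.nonempty
  have hc : ∀ i, D (simpleRoot i) (simpleRoot i) = D (simpleRoot o) (simpleRoot o) := by
    refine forall_of_adj_of_connected hconn (fun i j hij hi => ?_) rfl
    have h := hsymm (simpleRoot i) (simpleRoot j)
    rw [key i, key j, canonicalForm_comm M (simpleRoot j)] at h
    rw [← hi]
    exact (mul_right_cancel₀ (canonicalForm_ne_zero_of_adj hij) h).symm
  have hD : D = D (simpleRoot o) (simpleRoot o) • canonicalForm M :=
    linearMap_ext_simpleRoot fun i => LinearMap.ext fun v => by
      rw [key, hc]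
      rfl
  intro x hx
  have h := hpos x hx
  rw [hD] at h
  refine pos_of_mul_pos_right (a := D (simpleRoot o) (simpleRoot o)) h (hpos _ ?_).le
  intro h0
  simpa [simpleRoot_apply_self] using congrFun h0 o

end Connected

/-! ### Finite normal subgroups. -/

namespace CoxeterSystem

variable {S : Type*} [Fintype S] {M : CoxeterMatrix S} {W : Type*} [Group W]
  (cs : CoxeterSystem M W)

/-- Averaging the standard inner product over `W` yields an invariant positive definite form. -/
theorem isSpherical_of_finite (cs : CoxeterSystem M W) [Finite W] (hconn : (coxeterGraph M).Connected) :
    IsSpherical M := by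
  classical
  have := Fintype.ofFinite W
  let D : LinearMap.BilinForm ℝ (S → ℝ) :=
    ∑ w : W, (Matrix.toBilin' (1 : Matrix S S ℝ)).compl₁₂ (cs.geomRep w) (cs.geomRep w)
  have hD : ∀ x y, D x y = ∑ w : W, cs.geomRep w x ⬝ᵥ cs.geomRep w y := by
    intro x y
    simp [D, LinearMap.sum_apply, Matrix.toBilin'_apply']
  refine isSpherical_of_invariant_form hconn D ?_ ?_ ?_
  · intro x y
    simp only [hD, dotProduct_comm]
  · intro x hx
    rw [hD]
    refine Finset.sum_pos' (fun w _ => ?_) ⟨1, Finset.mem_univ _, ?_⟩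
    · exact Finset.sum_nonneg fun i _ => mul_self_nonneg _
    · obtain ⟨i, hi⟩ := Function.ne_iff.1 hx
      rw [map_one]
      exact Finset.sum_pos' (fun i _ => mul_self_nonneg _)
        ⟨i, Finset.mem_univ _, mul_self_pos.2 hi⟩
  · intro i x y
    rw [hD, hD, ← Equiv.sum_comp (Equiv.mulRight (cs.simple i))]
    refine (Finset.sum_congr rfl fun w _ => ?_)
    have h : ∀ v, cs.geomRep (w * cs.simple i) (simpleReflection M i v) = cs.geomRep w v := by
      intro v
      rw [← geomRep_simple cs, ← Module.End.mul_apply, ← map_mul, simple_mul_simple_cancel_right]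
    rw [Equiv.coe_mulRight, h, h]

/-- The sum of the elements of a finite subgroup in the geometric representation. -/
noncomputable def geomRepSum (K : Subgroup W) : Module.End ℝ (S → ℝ) :=
  ∑ᶠ k : K, cs.geomRep k

theorem geomRepSum_apply (K : Subgroup W) [Fintype K] (v : S → ℝ) :
    cs.geomRepSum K v = ∑ k : K, cs.geomRep k v := by
  rw [geomRepSum, finsum_eq_sum_of_fintype, LinearMap.sum_apply]

theorem geomRepSum_geomRep (K : Subgroup W) [Finite K] {k : W} (hk : k ∈ K) (v : S → ℝ) :
    cs.geomRepSum K (cs.geomRep k v) = cs.geomRepSum K v := by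
  have := Fintype.ofFinite K
  rw [geomRepSum_apply, geomRepSum_apply,
    ← Equiv.sum_comp (Equiv.mulRight (⟨k, hk⟩ : K)) fun x : K => cs.geomRep x v]
  simp [map_mul]

theorem geomRepSum_geomRep_eq_zero (K : Subgroup W) [Finite K] [K.Normal] {v : S → ℝ}
    (hv : cs.geomRepSum K v = 0) (w : W) : cs.geomRepSum K (cs.geomRep w v) = 0 := by
  have := Fintype.ofFinite K
  have h : cs.geomRepSum K (cs.geomRep w v) = cs.geomRep w (cs.geomRepSum K v) := by
    rw [geomRepSum_apply, geomRepSum_apply, map_sum,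
      ← Equiv.sum_comp (MulAut.conjNormal w : MulAut K).toEquiv]
    refine Finset.sum_congr rfl fun k _ => ?_
    simp [← Module.End.mul_apply, ← map_mul, MulAut.conjNormal_apply]
  rw [h, hv, map_zero]

theorem eq_bot_of_finite_of_normal (cs : CoxeterSystem M W) (hconn : (coxeterGraph M).Connected) (hns : ¬ IsSpherical M)
    (K : Subgroup W) [Finite K] [K.Normal] : K = ⊥ := by
  have := Fintype.ofFinite K
  by_cases hrad : ∃ u i, cs.geomRepSum K u = 0 ∧ canonicalForm M (simpleRoot i) u ≠ 0
  · exfalso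
    -- The reflection moves `u` by a nonzero multiple of the simple root, and the kernel is stable.
    have hstep : ∀ u i, cs.geomRepSum K u = 0 → canonicalForm M (simpleRoot i) u ≠ 0 →
        cs.geomRepSum K (simpleRoot i) = 0 := by
      intro u i hu hi
      have h := cs.geomRepSum_geomRep_eq_zero K hu (cs.simple i)
      rw [geomRep_simple, simpleReflection_apply, map_sub, hu, map_smul, zero_sub,
        neg_eq_zero, smul_eq_zero] at h
      exact h.resolve_left (mul_ne_zero two_ne_zero hi)
    obtain ⟨u, i, hu, hi⟩ := hrad
    have hall : ∀ j, cs.geomRepSum K (simpleRoot j) = 0 :=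
      forall_of_adj_of_connected hconn
        (fun i j hij h => hstep _ j h (canonicalForm_ne_zero_of_adj hij.symm)) (hstep u i hu hi)
    have hzero : cs.geomRepSum K = 0 := linearMap_ext_simpleRoot hall
    have : Finite W := by
      refine cs.finite_of_forall_exists_nonpos K (Set.toFinite _) fun v hv => ?_
      by_contra! hcon
      have hpos : ∀ k : K, 0 ≤ cs.geomRep k v := fun k =>
        (nonneg_or_nonpos_of_mem_roots (geomRep_mem_roots hv k)).resolve_right (hcon k k.2)
      have hsum := cs.geomRepSum_apply K v
      rw [hzero, LinearMap.zero_apply] at hsum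
      have h1 := (Finset.sum_eq_zero_iff_of_nonneg fun k _ => hpos k).1 hsum.symm 1
        (Finset.mem_univ _)
      exact hcon 1 K.one_mem h1.le
    exact hns (cs.isSpherical_of_finite hconn)
  · push Not at hrad
    have hker : ∀ u, cs.geomRepSum K u = 0 → u = 0 := by
      intro u hu
      have hfix : ∀ w, cs.geomRep w u = u := by
        intro w
        induction w using cs.simple_induction_left with
        | one => simp
        | mul_simple_left w i ih =>
          rw [map_mul, Module.End.mul_apply, ih, geomRep_simple, simpleReflection_apply,
            hrad u i hu]
          simp
      rw [geomRepSum_apply] at hu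
      simp only [hfix, Finset.sum_const, Finset.card_univ] at hu
      exact (smul_eq_zero.1 hu).resolve_left Fintype.card_ne_zero
    refine (Subgroup.eq_bot_iff_forall K).2 fun k hk => cs.geomRep_injective ?_
    rw [map_one]
    refine LinearMap.ext fun v => sub_eq_zero.1 (hker _ ?_)
    rw [map_sub, geomRepSum_geomRep cs K hk, Module.End.one_apply, sub_self]

end CoxeterSystem

/-! ### Dietzmann's lemma and normal closures. -/

section GroupTheory

variable {G : Type*} [Group G]

/-- A commutator depends only on the classes of its entries modulo the center. -/
theorem finite_commutatorSet_of_finiteIndex_center [(Subgroup.center G).FiniteIndex] :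
    Finite (commutatorSet G) := by
  have hfin : Finite (G ⧸ Subgroup.center G) := inferInstance
  refine (Set.finite_range fun p : (G ⧸ Subgroup.center G) × (G ⧸ Subgroup.center G) =>
    p.1.out * p.2.out * p.1.out⁻¹ * p.2.out⁻¹).subset ?_
  rintro _ ⟨a, b, rfl⟩
  obtain ⟨z, hz⟩ := QuotientGroup.mk_out_eq_mul (Subgroup.center G) a
  obtain ⟨z', hz'⟩ := QuotientGroup.mk_out_eq_mul (Subgroup.center G) b
  refine ⟨(a, b), ?_⟩
  have h1 := Subgroup.mem_center_iff.1 z.2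
  have h2 := Subgroup.mem_center_iff.1 z'.2
  simp only [hz, hz', commutatorElement_def]
  have e1 : ∀ g : G, g * z.1 = z.1 * g := h1
  have e2 : ∀ g : G, g * z'.1 = z'.1 * g := h2
  rw [mul_inv_rev, mul_inv_rev, e1 a]
  calc z.1 * a * (b * z'.1) * (z.1⁻¹ * a⁻¹) * (z'.1⁻¹ * b⁻¹)
      = z.1 * (a * b * z'.1) * z.1⁻¹ * a⁻¹ * z'.1⁻¹ * b⁻¹ := by group
    _ = a * b * z'.1 * a⁻¹ * z'.1⁻¹ * b⁻¹ := by rw [← e1 (a * b * z'.1), mul_inv_cancel_right]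
    _ = a * b * (z'.1 * a⁻¹) * z'.1⁻¹ * b⁻¹ := by group
    _ = a * b * a⁻¹ * b⁻¹ := by rw [← e2 a⁻¹]; group

theorem CommGroup.finite_of_closure_eq_top {A : Type*} [CommGroup A] {X : Set A} (hX : X.Finite)
    (hfin : ∀ x ∈ X, IsOfFinOrder x) (htop : Subgroup.closure X = ⊤) : Finite A := by
  have : Group.FG A := Group.fg_iff.2 ⟨X, htop, hX⟩
  refine CommGroup.finite_of_fg_isMulTorsion A fun a => ?_
  have h : Subgroup.closure X ≤ CommGroup.torsion A := (Subgroup.closure_le _).2 hfin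
  exact h (htop ▸ Subgroup.mem_top a)

/-- **Dietzmann's lemma**, for a generating set with centralizers of finite index. -/
theorem finite_of_closure_eq_top_of_finiteIndex_centralizer {X : Set G} (hX : X.Finite)
    (hfin : ∀ x ∈ X, IsOfFinOrder x)
    (hcent : (Subgroup.centralizer X).FiniteIndex) (htop : Subgroup.closure X = ⊤) :
    Finite G := by
  have hcenter : Subgroup.centralizer X = Subgroup.center G := by
    rw [← Subgroup.centralizer_closure, htop, Subgroup.coe_top, Subgroup.centralizer_univ]
  rw [hcenter] at hcent
  have := finite_commutatorSet_of_finiteIndex_center (G := G)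
  have : Finite (G ⧸ commutator G) := by
    change Finite (Abelianization G)
    refine CommGroup.finite_of_closure_eq_top (hX.image Abelianization.of) ?_ ?_
    · rintro _ ⟨x, hx, rfl⟩
      exact Abelianization.of.isOfFinOrder (hfin x hx)
    · rw [← MonoidHom.map_closure, htop, ← MonoidHom.range_eq_map,
        MonoidHom.range_eq_top.2 (QuotientGroup.mk_surjective)]
  -- Schur's theorem, found as an instance, makes `commutator G` finite.
  exact Finite.of_subgroup_quotient (commutator G)

/-- The conjugate of `H` by `g` depends only on the coset of `g` modulo the normalizer. -/
theorem finite_conjugatesOfSet (H : Subgroup G) [Finite H]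
    [(Subgroup.normalizer (H : Set G)).FiniteIndex] :
    (Group.conjugatesOfSet (H : Set G)).Finite := by
  refine (Set.finite_range fun p : (G ⧸ Subgroup.normalizer (H : Set G)) × H =>
    p.1.out * p.2.1 * p.1.out⁻¹).subset ?_
  intro x hx
  obtain ⟨a, ha, hax⟩ := Group.mem_conjugatesOfSet_iff.1 hx
  obtain ⟨g, rfl⟩ := isConj_iff.1 hax
  obtain ⟨n, hn⟩ := QuotientGroup.mk_out_eq_mul (Subgroup.normalizer (H : Set G)) g
  have hmem : n.1⁻¹ * a * n.1 ∈ H :=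
    (Subgroup.mem_normalizer_iff''.1 n.2 a).1 ha
  refine ⟨(g, ⟨_, hmem⟩), ?_⟩
  simp only [hn]
  group

theorem finiteIndex_centralizer_singleton {x : G} (hx : (conjugatesOf x).Finite) :
    (Subgroup.centralizer {x}).FiniteIndex := by
  have hf := hx.to_subtype
  have : Finite (G ⧸ Subgroup.centralizer {x}) := by
    refine Finite.of_injective (fun q : G ⧸ Subgroup.centralizer {x} =>
      (⟨q.out * x * q.out⁻¹, isConj_iff.2 ⟨_, rfl⟩⟩ : conjugatesOf x)) ?_
    intro p q hpq
    have h : p.out * x * p.out⁻¹ = q.out * x * q.out⁻¹ := congrArg Subtype.val hpq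
    rw [← p.out_eq', ← q.out_eq']
    refine QuotientGroup.eq.2 (Subgroup.mem_centralizer_singleton_iff.2 ?_)
    calc p.out⁻¹ * q.out * x = p.out⁻¹ * (q.out * x * q.out⁻¹) * q.out := by group
      _ = x * (p.out⁻¹ * q.out) := by rw [← h]; group
  exact Subgroup.finiteIndex_of_finite_quotient

theorem finite_normalClosure (H : Subgroup G) [Finite H]
    [(Subgroup.normalizer (H : Set G)).FiniteIndex] :
    Finite (Subgroup.normalClosure (H : Set G)) := by
  have hX := finite_conjugatesOfSet H
  set X := Group.conjugatesOfSet (H : Set G) with hXdef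
  have hXf := hX.to_subtype
  -- A finite intersection of centralizers of elements with finite conjugacy classes.
  have hcent : (Subgroup.centralizer X).FiniteIndex := by
    rw [Subgroup.centralizer_eq_iInf]
    have : ∀ x : X, (Subgroup.centralizer {x.1}).FiniteIndex := fun x =>
      finiteIndex_centralizer_singleton (hX.subset fun y hy => by
        obtain ⟨c, rfl⟩ := isConj_iff.1 hy
        exact Group.conj_mem_conjugatesOfSet x.2)
    rw [iInf_subtype']
    exact Subgroup.finiteIndex_iInf this
  refine finite_of_closure_eq_top_of_finiteIndex_centralizer
    (X := ((↑) : Subgroup.normalClosure (H : Set G) → G) ⁻¹' X)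
    (hX.preimage Subtype.val_injective.injOn) ?_ ?_ ?_
  · rintro ⟨x, hx'⟩ hx
    obtain ⟨a, ha, hax⟩ := Group.mem_conjugatesOfSet_iff.1 hx
    obtain ⟨c, hc⟩ := isConj_iff.1 hax
    rw [← Submonoid.isOfFinOrder_coe]
    have hao : IsOfFinOrder a := by
      have := isOfFinOrder_of_finite (⟨a, ha⟩ : H)
      exact Submonoid.isOfFinOrder_coe.2 this
    have := (MulAut.conj c).toMonoidHom.isOfFinOrder hao
    simpa [hc] using this
  · have hle : (Subgroup.centralizer X).subgroupOf (Subgroup.normalClosure (H : Set G)) ≤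
        Subgroup.centralizer (((↑) : Subgroup.normalClosure (H : Set G) → G) ⁻¹' X) := by
      intro y hy x hx
      exact Subtype.ext (Subgroup.mem_centralizer_iff.1 hy x hx)
    exact Subgroup.finiteIndex_of_le hle
  · exact Subgroup.closure_closure_coe_preimage

end GroupTheory

theorem proposition4p3 {S : Type*} [Fintype S] (M : CoxeterMatrix S)
    {W : Type*} [Group W] (cs : CoxeterSystem M W)
    (hconn : (coxeterGraph M).Connected) (hns : ¬ IsSpherical M)
    (H : Subgroup W) (hfin : Finite H) (hH : H ≠ ⊥) :
    Infinite (W ⧸ Subgroup.normalizer (H : Set W)) := by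
  by_contra hinf
  rw [not_infinite_iff_finite] at hinf
  have := Subgroup.finiteIndex_of_finite_quotient (H := Subgroup.normalizer (H : Set W))
  have := finite_normalClosure H
  have h := cs.eq_bot_of_finite_of_normal hconn hns (Subgroup.normalClosure (H : Set W))
  exact hH (le_bot_iff.1 (h ▸ Subgroup.le_normalClosure))
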